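/- For $\lambda>1$ and $\boldsymbol\mu=(1,\mu_1,\mu_2)$ with $\mu_1,\mu_2>0$, put $2\lambda_j=2\lambda-2+2j$ and $d_\ell=\sum_{j=0}^{\ell}\binom{\ell}{j}^2\frac{(\ell-j)!}{(2\lambda_j)_{\ell-j}}\mu_j^2$ ($\ell=0,1,2$, $\mu_0=1$, $(x)_k$ the rising factorial), and let $$K^{(\lambda,\boldsymbol\mu)}(z,w)=(1-z\bar w)^{-2\lambda-2}D(z\bar w)\exp(\bar w\,\mathbb S)\,B\,\exp(z\,\mathbb S^*)D(z\bar w),\qquad z,w\in\mathbb D,$$ where $B=\mathrm{diag}(d_0,d_1,d_2)$, $D(x)=\mathrm{diag}((1-x)^2,1-x,1)$, and $\mathbb S$ is the $3\times3$ matrix with $\mathbb S_{10}=1$, $\mathbb S_{21}=2$ and all other entries $0$ (indices $0,1,2$). Let $M^{(\lambda,\boldsymbol\mu)}$ be the operator of multiplication by the coordinate function on the Hilbert space of $\mathbb C^3$-valued functions on $\mathbb D$ with reproducing kernel $K=K^{(\lambda,\boldsymbol\mu)}$. Let $\tilde K(z,w)=K(0,0)^{1/2}K(z,0)^{-1}K(z,w)K(0,w)^{-1}K(0,0)^{1/2}$,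 $\tilde h(z)=\tilde K(z,z)^{t}$, and let $\mathcal K_{\lambda,\boldsymbol\mu}=\frac{\partial}{\partial\bar z}\big(\tilde h^{-1}\frac{\partial}{\partial z}\tilde h\big)$ be the curvature. All pairs $(\lambda,\boldsymbol\mu)$, $(\tilde\lambda,\tilde{\boldsymbol\mu})$, $(\hat\lambda,\hat{\boldsymbol\mu})$, $(\lambda',\boldsymbol\nu)$ below are of the above form, and $\mathcal K_{\lambda,\boldsymbol\mu}(0)=\mathrm{diag}(\delta_1,\delta_2,\delta_3)$. (a) Suppose $\delta_i>0$, $\delta_1\ne\delta_2$, $2(\delta_1+\delta_2)>\delta_3-6>\max\{2\delta_1-\delta_2,2\delta_2-\delta_1\}$, and $\mathcal K_{\tilde\lambda,\tilde{\boldsymbol\mu}}(0)=\mathrm{diag}(\delta_2,\delta_1,\delta_3)$. If $M^{(\lambda',\boldsymbol\nu)}$ is not unitarily equivalent to $M^{(\lambda,\boldsymbol\mu)}$ and $\mathcal K_{\lambda',\boldsymbol\nu}(0)$ and $\mathcal K_{\lambda,\boldsymbol\mu}(0)$ have the same set of eigenvalues, then $(\lambda',\boldsymbol\nu)=(\tilde\lambda,\tilde{\boldsymbol\mu})$.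 (b) Suppose $\delta_i>0$, $\delta_3>\delta_2>3+\frac{\delta_3}{2}$, $\delta_1<\min\{2\delta_3-\delta_2,2\delta_2-\delta_3\}-6$, and $\mathcal K_{\hat\lambda,\hat{\boldsymbol\mu}}(0)=\mathrm{diag}(\delta_1,\delta_3,\delta_2)$. If $M^{(\lambda',\boldsymbol\nu)}$ is not unitarily equivalent to $M^{(\lambda,\boldsymbol\mu)}$ and $\mathcal K_{\lambda',\boldsymbol\nu}(0)$ and $\mathcal K_{\lambda,\boldsymbol\mu}(0)$ have the same set of eigenvalues, then $(\lambda',\boldsymbol\nu)=(\hat\lambda,\hat{\boldsymbol\mu})$. (c) In general, without any inequalities on the $\delta_i$: if $M^{(\lambda',\boldsymbol\nu)}$ is not unitarily equivalent to $M^{(\lambda,\boldsymbol\mu)}$ and $\mathcal K_{\lambda',\boldsymbol\nu}(0)$ and $\mathcal K_{\lambda,\boldsymbol\mu}(0)$ have the same eigenvalues counted with multiplicity, then $\mathcal K_{\lambda',\boldsymbol\nu}(0)=\mathrm{diag}(\delta_2,\delta_1,\delta_3)$ or $\mathcal K_{\lambda',\boldsymbol\nu}(0)=\mathrm{diag}(\delta_1,\delta_3,\delta_2)$.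 -/

import Mathlib

noncomputable section

namespace KMKernel

open scoped ComplexConjugate ComplexOrder

/-- The number `2λ_j = 2λ - m + 2j`. -/
def twoLam (m : ℕ) (lam : ℝ) (j : ℕ) : ℝ := 2 * lam - m + 2 * j

/-- The lower triangular matrix `L(λ)`; `(x)_k` is the rising factorial. -/
def lowerL (m : ℕ) (lam : ℝ) : Matrix (Fin (m + 1)) (Fin (m + 1)) ℝ :=
  Matrix.of fun l j =>
    if j ≤ l then
      ((l : ℕ).choose j : ℝ) ^ 2 * (((l : ℕ) - (j : ℕ)).factorial : ℝ) /
        (ascPochhammer ℝ ((l : ℕ) - (j : ℕ))).eval (twoLam m lam j)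
    else 0

/-- The vector `d = L(λ) (μ_0², …, μ_m²)ᵗ`. -/
def dVec (m : ℕ) (lam : ℝ) (mu : Fin (m + 1) → ℝ) : Fin (m + 1) → ℝ :=
  (lowerL m lam).mulVec fun j => mu j ^ 2

/-- `B = diag(d_0, …, d_m)`. -/
def matB (m : ℕ) (lam : ℝ) (mu : Fin (m + 1) → ℝ) : Matrix (Fin (m + 1)) (Fin (m + 1)) ℂ :=
  Matrix.diagonal fun l => (dVec m lam mu l : ℂ)

/-- The forward shift `𝕊_m` with weights `1, …, m`. -/
def shift (m : ℕ) : Matrix (Fin (m + 1)) (Fin (m + 1)) ℂ :=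
  Matrix.of fun l p => if (p : ℕ) + 1 = l then ((l : ℕ) : ℂ) else 0

/-- `D(x) = diag((1 - x)^m, …, 1 - x, 1)`. -/
def matD (m : ℕ) (x : ℂ) : Matrix (Fin (m + 1)) (Fin (m + 1)) ℂ :=
  Matrix.diagonal fun l => (1 - x) ^ (m - (l : ℕ))

/-- The kernel
`K^{(λ,μ)}(z,w) = (1 - z w̄)^{-2λ-m} D(z w̄) exp(w̄ 𝕊_m) B exp(z 𝕊_m*) D(z w̄)`. -/
def kernel (m : ℕ) (lam : ℝ) (mu : Fin (m + 1) → ℝ) (z w : ℂ) :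
    Matrix (Fin (m + 1)) (Fin (m + 1)) ℂ :=
  (1 - z * conj w) ^ (-(2 * (lam : ℂ)) - (m : ℂ)) •
    (matD m (z * conj w) * NormedSpace.exp (conj w • shift m) * matB m lam mu *
      NormedSpace.exp (z • (shift m).conjTranspose) * matD m (z * conj w))

/-- Parameters `(λ, μ)` for `m = 2`: `λ > 1`, `μ = (1, μ₁, μ₂)`, `μ₁, μ₂ > 0`. -/
@[ext]
structure Params where
  lam : ℝ
  mu₁ : ℝ
  mu₂ : ℝ
  one_lt_lam : 1 < lam
  mu₁_pos : 0 < mu₁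
  mu₂_pos : 0 < mu₂

/-- The vector `μ = (1, μ₁, μ₂)`. -/
def Params.mu (p : Params) : Fin 3 → ℝ := ![1, p.mu₁, p.mu₂]

/-- The kernel `K^{(λ,μ)}` for `m = 2`. -/
def Params.ker (p : Params) (z w : ℂ) : Matrix (Fin 3) (Fin 3) ℂ :=
  kernel 2 p.lam p.mu z w

section positivity

/-- Taylor coefficients of `(1 - x)^(-s)`. -/
def coef (s : ℝ) (n : ℕ) : ℝ := (ascPochhammer ℝ n).eval s / n.factorial

lemma coef_nonneg {s : ℝ} (hs : 0 < s) (n : ℕ) : 0 ≤ coef s n :=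
  div_nonneg (ascPochhammer_pos n s hs).le (Nat.cast_nonneg _)

lemma coef_succ (s : ℝ) (n : ℕ) :
    ((n : ℂ) + 1) * coef s (n + 1) = s * coef (s + 1) n := by
  have h : (n.factorial : ℝ) ≠ 0 := by exact_mod_cast n.factorial_ne_zero
  have h1 : (n : ℝ) + 1 ≠ 0 := by positivity
  have : ((n : ℝ) + 1) * coef s (n + 1) = s * coef (s + 1) n := by
    simp only [coef, ascPochhammer_succ_left, Polynomial.eval_mul, Polynomial.eval_X,
      Polynomial.eval_comp, Polynomial.eval_add, Polynomial.eval_one, Nat.factorial_succ]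
    push_cast
    field_simp
  exact_mod_cast congrArg (fun r : ℝ => (r : ℂ)) this

lemma coef_eq (s : ℝ) (n : ℕ) : (coef s n : ℂ) = Ring.choose ((s : ℂ) + n - 1) n := by
  have h : (n.factorial : ℂ) ≠ 0 := by exact_mod_cast n.factorial_ne_zero
  have h2 := Ring.factorial_nsmul_multichoose_eq_ascPochhammer (s : ℂ) n
  rw [Polynomial.ascPochhammer_smeval_eq_eval, nsmul_eq_mul] at h2
  have h3 : ((Polynomial.eval s (ascPochhammer ℝ n) : ℝ) : ℂ)
      = Polynomial.eval (s : ℂ) (ascPochhammer ℂ n) := by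
    rw [← ascPochhammer_map Complex.ofRealHom n, Polynomial.eval_map]
    exact (Polynomial.eval₂_at_apply Complex.ofRealHom s).symm
  rw [Ring.choose, show (s : ℂ) + n - 1 - n + 1 = s by ring, coef]
  push_cast
  rw [h3, ← h2]
  field_simp

lemma hasSum_coef (s : ℝ) {x : ℂ} (hx : ‖x‖ < 1) :
    HasSum (fun n : ℕ => (coef s n : ℂ) * x ^ n) ((1 - x) ^ (-(s : ℂ))) := by
  have h := (Complex.one_div_one_sub_cpow_hasFPowerSeriesOnBall_zero (s : ℂ)).hasSum
    (y := x) (by simpa [enorm_eq_nnnorm, ← NNReal.coe_lt_coe] using hx)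
  simp only [FormalMultilinearSeries.ofScalars_apply_eq, smul_eq_mul, zero_add,
    ← coef_eq] at h
  rwa [Complex.cpow_neg, ← one_div]

lemma hasSum_shift {f : ℕ → ℂ} {a : ℂ} (h0 : f 0 = 0) (h : HasSum (fun n => f (n + 1)) a) :
    HasSum f a := by
  have := (hasSum_nat_add_iff (f := f) 1).mp h
  simpa [h0] using this

lemma hasSum_of {f g : ℕ → ℂ} {a b : ℂ} (h : HasSum g b) (hfg : ∀ n, f n = g n) (hab : a = b) :
    HasSum f a := by
  rw [hab, show f = g from funext hfg]
  exact h

/-- `P s x = (1 - x)^(-s)` -/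
def P (s : ℝ) (x : ℂ) : ℂ := (1 - x) ^ (-(s : ℂ))

lemma P_succ (s : ℝ) {x : ℂ} (hx : ‖x‖ < 1) : P s x = (1 - x) * P (s + 1) x := by
  have h : 1 - x ≠ 0 := by
    intro h
    rw [← sub_eq_zero.mp h] at hx
    simp at hx
  rw [P, P, show (-(s : ℂ)) = 1 + (-((s + 1 : ℝ) : ℂ)) by push_cast; ring,
    Complex.cpow_add _ _ h, Complex.cpow_one]

lemma hasSum_zz (s : ℝ) {z v : ℂ} (hx : ‖z * v‖ < 1) :
    HasSum (fun n : ℕ => (coef s n : ℂ) * (z ^ n * v ^ n)) (P s (z * v)) :=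
  (hasSum_coef s hx).congr_fun fun n => by rw [mul_pow]

lemma hasSum_oz (s : ℝ) {z v : ℂ} (hx : ‖z * v‖ < 1) :
    HasSum (fun n : ℕ => (coef s n : ℂ) * (n * z ^ (n - 1) * v ^ n))
      (s * v * P (s + 1) (z * v)) := by
  refine hasSum_shift (by simp) (((hasSum_zz (s + 1) hx).mul_left (s * v : ℂ)).congr_fun ?_)
  intro n
  push_cast
  linear_combination z ^ n * v ^ (n + 1) * coef_succ s n

lemma hasSum_oo (s : ℝ) {z v : ℂ} (hx : ‖z * v‖ < 1) :
    HasSum (fun n : ℕ => (coef s n : ℂ) * (n * z ^ (n - 1) * (n * v ^ (n - 1))))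
      (s * ((s + 1) * (z * v) * P (s + 2) (z * v) + P (s + 1) (z * v))) := by
  have h := (((hasSum_oz (s + 1) hx).mul_left z).add (hasSum_zz (s + 1) hx)).mul_left (s : ℂ)
  rw [show s + 1 + 1 = s + 2 by ring] at h
  refine hasSum_shift (by simp) (hasSum_of h (fun n => ?_) ?_)
  · rcases n with _ | n
    · have := coef_succ s 0
      simp at this
      simp [this]
    · have := coef_succ s (n + 1)
      push_cast at this ⊢
      linear_combination z ^ (n + 1) * v ^ (n + 1) * (n + 2) * this
  · push_cast; ring

lemma hasSum_tz (s : ℝ) {z v : ℂ} (hx : ‖z * v‖ < 1) :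
    HasSum (fun n : ℕ => (coef s n : ℂ) * (n * (n - 1) * z ^ (n - 2) * v ^ n))
      (s * (s + 1) * v ^ 2 * P (s + 2) (z * v)) := by
  have h := (hasSum_oz (s + 1) hx).mul_left (s * v : ℂ)
  rw [show s + 1 + 1 = s + 2 by ring] at h
  refine hasSum_shift (by simp) (hasSum_of h (fun n => ?_) ?_)
  · have := coef_succ s n
    push_cast
    linear_combination z ^ (n - 1) * v ^ (n + 1) * n * this
  · push_cast; ring

lemma hasSum_to (s : ℝ) {z v : ℂ} (hx : ‖z * v‖ < 1) :
    HasSum (fun n : ℕ => (coef s n : ℂ) * (n * (n - 1) * z ^ (n - 2) * (n * v ^ (n - 1))))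
      (s * (s + 1) * v * ((s + 2) * (z * v) * P (s + 3) (z * v) + 2 * P (s + 2) (z * v))) := by
  have h := ((hasSum_oo (s + 1) hx).mul_left (s * v : ℂ)).add
    ((hasSum_oz (s + 1) hx).mul_left (s : ℂ))
  rw [show s + 1 + 1 = s + 2 by ring, show s + 1 + 2 = s + 3 by ring] at h
  refine hasSum_shift (by simp) (hasSum_of h (fun n => ?_) ?_)
  · have := coef_succ s n
    push_cast
    rcases n with _ | n
    · simp
    · simp only [Nat.add_sub_cancel]
      push_cast at this ⊢
      linear_combination z ^ n * v ^ (n + 1) * (n + 1) * (n + 2) * this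
  · push_cast; ring

lemma hasSum_tt (s : ℝ) {z v : ℂ} (hx : ‖z * v‖ < 1) :
    HasSum (fun n : ℕ => (coef s n : ℂ) *
        (n * (n - 1) * z ^ (n - 2) * (n * (n - 1) * v ^ (n - 2))))
      (s * (s + 1) * ((s + 2) * (s + 3) * (z * v) ^ 2 * P (s + 4) (z * v)
        + 4 * (s + 2) * (z * v) * P (s + 3) (z * v) + 2 * P (s + 2) (z * v))) := by
  have hx' : ‖v * z‖ < 1 := by rwa [mul_comm]
  have h := (((hasSum_to (s + 1) hx).mul_left z).add
    ((hasSum_oo (s + 1) hx).mul_left (2 : ℂ))).mul_left (s : ℂ)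
  rw [show s + 1 + 1 = s + 2 by ring, show s + 1 + 2 = s + 3 by ring,
    show s + 1 + 3 = s + 4 by ring] at h
  refine hasSum_shift (by simp) (hasSum_of h (fun n => ?_) ?_)
  · have := coef_succ s n
    push_cast
    rcases n with _ | _ | n
    · simp
    · simp at this ⊢
      linear_combination 2 * this
    · simp only [show n + 1 + 1 - 1 = n + 1 by omega] at this ⊢
      push_cast at this ⊢
      linear_combination z ^ (n + 1) * v ^ (n + 1) * (n + 2) ^ 2 * (n + 3) * this
  · push_cast; ring

lemma exp_shift (v : ℂ) :
    NormedSpace.exp (v • shift 2) = !![1, 0, 0; v, 1, 0; v ^ 2, 2 * v, 1] := by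
  have hS : v • shift 2 = !![0, 0, 0; v, 0, 0; 0, 2 * v, 0] := by
    ext i j
    fin_cases i <;> fin_cases j <;> simp [shift, mul_comm]
  have h2 : (v • shift 2) ^ 2 = !![0, 0, 0; 0, 0, 0; 2 * v ^ 2, 0, 0] := by
    rw [hS, pow_two]
    ext i j
    fin_cases i <;> fin_cases j <;> simp [Matrix.mul_apply, Fin.sum_univ_three]
    ring
  have h3 : (v • shift 2) ^ 3 = 0 := by
    rw [pow_succ, h2, hS]
    ext i j
    fin_cases i <;> fin_cases j <;> simp [Matrix.mul_apply, Fin.sum_univ_three]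
  have h : NormedSpace.exp (v • shift 2) =
      ∑ n ∈ Finset.range 3, (n.factorial⁻¹ : ℂ) • (v • shift 2) ^ n := by
    rw [NormedSpace.exp_eq_tsum ℂ]
    refine tsum_eq_sum fun n hn => ?_
    rw [Finset.mem_range, not_lt] at hn
    rw [pow_eq_zero_of_le hn h3, smul_zero]
  rw [h, Finset.sum_range_succ, Finset.sum_range_succ, Finset.sum_range_one, h2, pow_one, hS]
  ext i j
  fin_cases i <;> fin_cases j <;> simp

lemma exp_shift_adj (z : ℂ) :
    NormedSpace.exp (z • (shift 2).conjTranspose) = !![1, z, z ^ 2; 0, 1, 2 * z; 0, 0, 1] := by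
  have h : z • (shift 2).conjTranspose = (z • shift 2).transpose := by
    ext i j
    fin_cases i <;> fin_cases j <;> simp [shift]
  rw [h, Matrix.exp_transpose, exp_shift]
  ext i j
  fin_cases i <;> fin_cases j <;> simp

lemma dVec_two (p : Params) :
    dVec 2 p.lam p.mu = ![1, 1 / (2 * p.lam - 2) + p.mu₁ ^ 2,
      2 / ((2 * p.lam - 2) * (2 * p.lam - 1)) + 2 / p.lam * p.mu₁ ^ 2 + p.mu₂ ^ 2] := by
  have h := p.one_lt_lam
  have h1 : 2 * p.lam - 2 ≠ 0 := by linarith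
  have h2 : 2 * p.lam - 1 ≠ 0 := by linarith
  have h3 : p.lam ≠ 0 := by linarith
  ext i
  fin_cases i
  · simp [dVec, lowerL, Matrix.mulVec, dotProduct, Params.mu]
  · simp [dVec, lowerL, Matrix.mulVec, dotProduct, Fin.sum_univ_three, Params.mu, twoLam]
  · simp [dVec, lowerL, Matrix.mulVec, dotProduct, Fin.sum_univ_three, Params.mu, twoLam,
      ascPochhammer_succ_right]
    rw [show 2 * p.lam - 2 + 1 = 2 * p.lam - 1 by ring]
    field_simp

lemma ker_entries (p : Params) (z w : ℂ) : p.ker z w =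
    (1 - z * conj w) ^ (-(2 * (p.lam : ℂ)) - 2) •
    Matrix.of fun l k : Fin 3 => (1 - z * conj w) ^ (2 - (l : ℕ)) * (1 - z * conj w) ^ (2 - (k : ℕ)) *
    !![1, z, z ^ 2;
       conj w, z * conj w + dVec 2 p.lam p.mu 1, z ^ 2 * conj w + 2 * dVec 2 p.lam p.mu 1 * z;
       conj w ^ 2, z * conj w ^ 2 + 2 * dVec 2 p.lam p.mu 1 * conj w,
        (z * conj w) ^ 2 + 4 * (z * conj w) * dVec 2 p.lam p.mu 1 + dVec 2 p.lam p.mu 2] l k := by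
  have h0 : dVec 2 p.lam p.mu 0 = 1 := by rw [dVec_two]; rfl
  unfold Params.ker kernel
  rw [exp_shift, exp_shift_adj]
  push_cast
  congr 1
  ext i j
  fin_cases i <;> fin_cases j <;>
    simp [Matrix.mul_apply, Fin.sum_univ_three, matD, matB, h0] <;> ring

/-- The exponents of the three scalar kernels of which `K^{(λ,μ)}` is built. -/
def Params.expo (p : Params) : Fin 3 → ℝ := ![2 * p.lam - 2, 2 * p.lam, 2 * p.lam + 2]

/-- The vectors in the expansion of `K^{(λ,μ)}` as a sum of rank one kernels. -/
def Params.vec (p : Params) (j : Fin 3) (n : ℕ) (z : ℂ) : Fin 3 → ℂ :=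
  ![![z ^ n, (2 * p.lam - 2 : ℂ)⁻¹ * (n * z ^ (n - 1)),
      ((2 * p.lam - 2 : ℂ) * (2 * p.lam - 1))⁻¹ * (n * (n - 1) * z ^ (n - 2))],
    ![0, z ^ n, (p.lam : ℂ)⁻¹ * (n * z ^ (n - 1))],
    ![0, 0, z ^ n]] j

lemma vec_conj (p : Params) (j : Fin 3) (n : ℕ) (w : ℂ) (k : Fin 3) :
    conj (p.vec j n w k) = p.vec j n (conj w) k := by
  fin_cases j <;> fin_cases k <;>
    simp [Params.vec, map_ofNat (starRingEnd ℂ) 2]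

lemma ker_hasSum (p : Params) {z w : ℂ} (hx : ‖z * conj w‖ < 1) (l k : Fin 3) :
    HasSum (fun n => ∑ j, ((p.mu j ^ 2 * coef (p.expo j) n : ℝ) : ℂ) *
      (p.vec j n z l * conj (p.vec j n w k))) (p.ker z w l k) := by
  simp only [vec_conj]
  have hlam := p.one_lt_lam
  have h1 : (2 * p.lam - 2 : ℂ) ≠ 0 := by
    exact_mod_cast (show (2 * p.lam - 2 : ℝ) ≠ 0 by linarith)
  have h4 : (p.lam - 1 : ℂ) ≠ 0 := by
    exact_mod_cast (show (p.lam - 1 : ℝ) ≠ 0 by linarith)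
  have h2 : (2 * p.lam - 1 : ℂ) ≠ 0 := by
    exact_mod_cast (show (2 * p.lam - 1 : ℝ) ≠ 0 by linarith)
  have h3 : (p.lam : ℂ) ≠ 0 := by exact_mod_cast (show (p.lam : ℝ) ≠ 0 by linarith)
  rw [ker_entries]
  generalize conj w = v at *
  have hx' : ‖v * z‖ < 1 := by rwa [mul_comm]
  have hd1 : ((dVec 2 p.lam p.mu 1 : ℝ) : ℂ) = 1 / (2 * p.lam - 2) + p.mu₁ ^ 2 := by
    rw [dVec_two]; simp
  have hd2 : ((dVec 2 p.lam p.mu 2 : ℝ) : ℂ) =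
      2 / ((2 * p.lam - 2) * (2 * p.lam - 1)) + 2 / p.lam * p.mu₁ ^ 2 + p.mu₂ ^ 2 := by
    rw [dVec_two]; simp
  have hQ : (1 - z * v) ^ (-(2 * (p.lam : ℂ)) - 2) = P (2 * p.lam + 2) (z * v) := by
    rw [P]; congr 1; push_cast; ring
  have q1 := P_succ (2 * p.lam + 1) hx
  have q0 := P_succ (2 * p.lam) hx
  have qm1 := P_succ (2 * p.lam - 1) hx
  have qm2 := P_succ (2 * p.lam - 2) hx
  rw [show 2 * p.lam + 1 + 1 = 2 * p.lam + 2 by ring] at q1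
  rw [q1] at q0
  rw [show 2 * p.lam - 1 + 1 = 2 * p.lam by ring, q0] at qm1
  rw [show 2 * p.lam - 2 + 1 = 2 * p.lam - 1 by ring, qm1] at qm2
  have e1 : 2 * p.lam - 2 + 1 = 2 * p.lam - 1 := by ring
  have e2 : 2 * p.lam - 2 + 2 = 2 * p.lam := by ring
  have e3 : 2 * p.lam - 2 + 3 = 2 * p.lam + 1 := by ring
  have e4 : 2 * p.lam - 2 + 4 = 2 * p.lam + 2 := by ring
  rw [hQ]
  simp only [Matrix.smul_apply, Matrix.of_apply, smul_eq_mul]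
  rw [hd1, hd2]
  fin_cases l <;> fin_cases k
  · refine hasSum_of (hasSum_zz (2 * p.lam - 2) hx) (fun n => ?_) ?_
    · simp [Fin.sum_univ_three, Params.mu, Params.vec, Params.expo]
    · rw [qm2]; simp; ring
  · refine hasSum_of ((hasSum_oz (2 * p.lam - 2) hx').mul_left (2 * p.lam - 2 : ℂ)⁻¹)
      (fun n => ?_) ?_
    · simp [Fin.sum_univ_three, Params.mu, Params.vec, Params.expo]; ring
    · rw [e1, mul_comm v z, qm1]; simp; field_simp
  · refine hasSum_of ((hasSum_tz (2 * p.lam - 2) hx').mul_left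
      ((2 * p.lam - 2 : ℂ) * (2 * p.lam - 1))⁻¹) (fun n => ?_) ?_
    · simp [Fin.sum_univ_three, Params.mu, Params.vec, Params.expo]; ring
    · rw [e2, mul_comm v z, q0]; simp; field_simp; ring
  · refine hasSum_of ((hasSum_oz (2 * p.lam - 2) hx).mul_left (2 * p.lam - 2 : ℂ)⁻¹)
      (fun n => ?_) ?_
    · simp [Fin.sum_univ_three, Params.mu, Params.vec, Params.expo]; ring
    · rw [e1, qm1]; simp; field_simp
  · refine hasSum_of (((hasSum_oo (2 * p.lam - 2) hx).mul_left ((2 * p.lam - 2 : ℂ)⁻¹ * (2 * p.lam - 2 : ℂ)⁻¹)).add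
      ((hasSum_zz (2 * p.lam) hx).mul_left (p.mu₁ ^ 2 : ℂ))) (fun n => ?_) ?_
    · simp [Fin.sum_univ_three, Params.mu, Params.vec, Params.expo]; ring
    · rw [e1, e2, qm1, q0]; simp; field_simp; ring
  · refine hasSum_of (((hasSum_to (2 * p.lam - 2) hx').mul_left
      ((2 * p.lam - 2 : ℂ)⁻¹ * ((2 * p.lam - 2 : ℂ) * (2 * p.lam - 1))⁻¹)).add
      ((hasSum_oz (2 * p.lam) hx').mul_left (p.mu₁ ^ 2 * (p.lam : ℂ)⁻¹ : ℂ))) (fun n => ?_) ?_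
    · simp [Fin.sum_univ_three, Params.mu, Params.vec, Params.expo]; ring
    · rw [e2, e3, mul_comm v z, q0, q1]; simp; field_simp; ring
  · refine hasSum_of ((hasSum_tz (2 * p.lam - 2) hx).mul_left
      ((2 * p.lam - 2 : ℂ) * (2 * p.lam - 1))⁻¹) (fun n => ?_) ?_
    · simp [Fin.sum_univ_three, Params.mu, Params.vec, Params.expo]; ring
    · rw [e2, q0]; simp; field_simp; ring
  · refine hasSum_of (((hasSum_to (2 * p.lam - 2) hx).mul_left
      ((2 * p.lam - 2 : ℂ)⁻¹ * ((2 * p.lam - 2 : ℂ) * (2 * p.lam - 1))⁻¹)).add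
      ((hasSum_oz (2 * p.lam) hx).mul_left (p.mu₁ ^ 2 * (p.lam : ℂ)⁻¹ : ℂ))) (fun n => ?_) ?_
    · simp [Fin.sum_univ_three, Params.mu, Params.vec, Params.expo]; ring
    · rw [e2, e3, q0, q1]; simp; field_simp; ring
  · refine hasSum_of ((((hasSum_tt (2 * p.lam - 2) hx).mul_left
      (((2 * p.lam - 2 : ℂ) * (2 * p.lam - 1))⁻¹ ^ 2)).add
      ((hasSum_oo (2 * p.lam) hx).mul_left (p.mu₁ ^ 2 * (p.lam : ℂ)⁻¹ ^ 2 : ℂ))).add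
      ((hasSum_zz (2 * p.lam + 2) hx).mul_left (p.mu₂ ^ 2 : ℂ))) (fun n => ?_) ?_
    · simp [Fin.sum_univ_three, Params.mu, Params.vec, Params.expo]; ring
    · rw [e2, e3, e4, q0, q1]; simp; field_simp; ring

/-- The kernel `K^{(λ,μ)}` on the disc, with matrices acting on Euclidean `ℂ³`. -/
def Params.opKer (p : Params) :
    Matrix Complex.UnitDisc Complex.UnitDisc
      (EuclideanSpace ℂ (Fin 3) →L[ℂ] EuclideanSpace ℂ (Fin 3)) :=
  Matrix.of fun z w => Matrix.toEuclideanCLM (𝕜 := ℂ) (p.ker z w)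

lemma norm_mul_conj_lt (z w : Complex.UnitDisc) : ‖(z : ℂ) * conj (w : ℂ)‖ < 1 := by
  rw [norm_mul, RCLike.norm_conj]
  exact mul_lt_one_of_nonneg_of_lt_one_left (norm_nonneg _) z.norm_lt_one w.norm_lt_one.le

lemma inner_opKer (p : Params) (z w : Complex.UnitDisc) (a b : EuclideanSpace ℂ (Fin 3)) :
    inner ℂ (p.opKer z w a) b = ∑ l, ∑ k, b l * conj (p.ker z w l k) * conj (a k) := by
  simp only [Params.opKer, Matrix.of_apply, PiLp.inner_apply, RCLike.inner_apply,
    Matrix.ofLp_toEuclideanCLM, Matrix.mulVec, dotProduct, map_sum, map_mul, Finset.mul_sum]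
  exact Finset.sum_congr rfl fun l _ => Finset.sum_congr rfl fun k _ => by ring

lemma ker_conj (p : Params) (z w : Complex.UnitDisc) (l k : Fin 3) :
    conj (p.ker z w l k) = p.ker w z k l := by
  have h := ker_hasSum p (norm_mul_conj_lt z w) l k
  have h' := ker_hasSum p (norm_mul_conj_lt w z) k l
  refine HasSum.unique ((Complex.hasSum_conj').mpr h) ?_
  refine h'.congr_fun fun n => ?_
  rw [map_sum]
  refine Finset.sum_congr rfl fun j _ => ?_
  simp only [map_mul, Complex.conj_ofReal, Complex.conj_conj]
  ring

lemma opKer_posSemidef (p : Params) : p.opKer.PosSemidef := by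
  have tfae := (RKHS.posSemidef_tfae (K := p.opKer)).out 0 2
  refine tfae.mpr ⟨?_, fun vv => ?_⟩
  · refine Matrix.ext fun z w => ContinuousLinearMap.ext fun a => ext_inner_right ℂ fun b => ?_
    rw [Matrix.conjTranspose_apply, ContinuousLinearMap.star_eq_adjoint,
      ContinuousLinearMap.adjoint_inner_left, ← inner_conj_symm, inner_opKer, inner_opKer]
    simp only [map_sum, map_mul, Complex.conj_conj, ker_conj]
    rw [Finset.sum_comm]
    exact Finset.sum_congr rfl fun l _ => Finset.sum_congr rfl fun k _ => by ring
  · let S : Fin 3 → ℕ → ℂ := fun j n =>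
      ∑ x ∈ vv.support, ∑ k, p.vec j n x k * conj (vv x k)
    have key : HasSum (fun n => ∑ j, ((p.mu j ^ 2 * coef (p.expo j) n : ℝ) : ℂ) *
        (S j n * conj (S j n)))
        (vv.sum fun x a => vv.sum fun x' b => inner ℂ (p.opKer x' x a) b) := by
      simp only [Finsupp.sum, inner_opKer]
      have h : HasSum (fun n => ∑ x ∈ vv.support, ∑ x' ∈ vv.support, ∑ l, ∑ k,
          vv x' l * (∑ j, ((p.mu j ^ 2 * coef (p.expo j) n : ℝ) : ℂ) *
            (conj (p.vec j n x' l) * p.vec j n x k)) * conj (vv x k))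
          (∑ x ∈ vv.support, ∑ x' ∈ vv.support, ∑ l, ∑ k,
            vv x' l * conj (p.ker x' x l k) * conj (vv x k)) := by
        refine hasSum_sum fun x _ => hasSum_sum fun x' _ => hasSum_sum fun l _ =>
          hasSum_sum fun k _ => HasSum.mul_right _ (HasSum.mul_left _ ?_)
        refine ((Complex.hasSum_conj').mpr
          (ker_hasSum p (norm_mul_conj_lt x' x) l k)).congr_fun fun n => ?_
        rw [map_sum]
        refine Finset.sum_congr rfl fun j _ => ?_
        simp only [map_mul, Complex.conj_ofReal, Complex.conj_conj]
      refine h.congr_fun fun n => ?_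
      have hS : ∀ j, S j n * conj (S j n) = ∑ x ∈ vv.support, ∑ x' ∈ vv.support, ∑ l, ∑ k,
          (p.vec j n x k * conj (vv x k)) * (conj (p.vec j n x' l) * vv x' l) := by
        intro j
        simp only [S, map_sum, map_mul, Complex.conj_conj, Finset.sum_mul_sum]
        exact Finset.sum_congr rfl fun x _ => Finset.sum_congr rfl fun x' _ => Finset.sum_comm
      simp only [hS, Finset.mul_sum, Finset.sum_mul]
      rw [Finset.sum_comm]
      refine Finset.sum_congr rfl fun x _ => ?_
      rw [Finset.sum_comm]
      refine Finset.sum_congr rfl fun x' _ => ?_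
      rw [Finset.sum_comm]
      refine Finset.sum_congr rfl fun l _ => ?_
      rw [Finset.sum_comm]
      exact Finset.sum_congr rfl fun k _ => Finset.sum_congr rfl fun j _ => by ring
    have hre := Complex.hasSum_re key
    refine hre.nonneg fun n => ?_
    rw [Complex.re_sum]
    refine Finset.sum_nonneg fun j _ => ?_
    rw [Complex.mul_conj, ← Complex.ofReal_mul, Complex.ofReal_re]
    have h := p.one_lt_lam
    have : 0 < p.expo j := by
      fin_cases j <;> simp [Params.expo] <;> linarith
    exact mul_nonneg (mul_nonneg (sq_nonneg _) (coef_nonneg this n)) (Complex.normSq_nonneg _)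

end positivity

instance (p : Params) : Fact p.opKer.PosSemidef := ⟨opKer_posSemidef p⟩

/-- The Hilbert space `𝐀^{(λ,μ)}(𝔻)` of `ℂ³`-valued functions on the disc with reproducing kernel
`K^{(λ,μ)}`. -/
abbrev Params.space (p : Params) : Type := RKHS.OfKernel p.opKer

/-- The operator of multiplication by the coordinate function on a reproducing kernel Hilbert
space of functions on the disc, on its natural domain `{f | z f ∈ H}` (which is all of `H` exactly
when multiplication by `z` is a bounded operator on `H`). -/
def mulOperator (H : Type*) {V : Type*} [NormedAddCommGroup V] [InnerProductSpace ℂ V]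
    [NormedAddCommGroup H] [InnerProductSpace ℂ H] [RKHS ℂ H Complex.UnitDisc V] : H →ₗ.[ℂ] H where
  domain :=
    { carrier := {f | ∃ g : H, ∀ z : Complex.UnitDisc, g z = (z : ℂ) • f z}
      add_mem' := by
        rintro f₁ f₂ ⟨g₁, h₁⟩ ⟨g₂, h₂⟩
        exact ⟨g₁ + g₂, fun z => by simp [h₁, h₂]⟩
      zero_mem' := ⟨0, fun z => by simp⟩
      smul_mem' := by
        rintro c f ⟨g, h⟩
        exact ⟨c • g, fun z => by simp [h, smul_comm c]⟩ }
  toFun :=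
    { toFun := fun f => f.2.choose
      map_add' := fun f₁ f₂ => by
        ext z
        rw [RKHS.coe_add, Pi.add_apply, f₁.2.choose_spec z, f₂.2.choose_spec z, ← smul_add]
        exact ((f₁ + f₂).2.choose_spec z).trans (by rw [Submodule.coe_add, RKHS.coe_add]; rfl)
      map_smul' := fun c f => by
        ext z
        rw [RingHom.id_apply, RKHS.coe_smul, Pi.smul_apply, f.2.choose_spec z, smul_comm]
        exact ((c • f).2.choose_spec z).trans (by rw [Submodule.coe_smul, RKHS.coe_smul]; rfl) }

lemma mem_graph_mulOperator {H : Type*} {V : Type*} [NormedAddCommGroup V]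
    [InnerProductSpace ℂ V] [NormedAddCommGroup H] [InnerProductSpace ℂ H]
    [RKHS ℂ H Complex.UnitDisc V] (f g : H) :
    (f, g) ∈ (mulOperator H).graph ↔ ∀ z : Complex.UnitDisc, g z = (z : ℂ) • f z := by
  rw [LinearPMap.mem_graph_iff]
  constructor
  · rintro ⟨y, rfl, rfl⟩
    exact y.2.choose_spec
  · intro h
    refine ⟨⟨f, g, h⟩, rfl, ?_⟩
    refine RKHS.ext fun z => ?_
    exact ((⟨g, h⟩ : ∃ g : H, ∀ z : Complex.UnitDisc, g z = (z : ℂ) • f z).choose_spec z).trans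
      (h z).symm

/-- The multiplication operator `M^{(λ,μ)}`. -/
def Params.mulOp (p : Params) : p.space →ₗ.[ℂ] p.space := mulOperator p.space

/-- Unitary equivalence: a unitary carries the graph of `T` onto the graph of `S`. -/
def UnitarilyEquivalent {H₁ H₂ : Type*} [NormedAddCommGroup H₁] [InnerProductSpace ℂ H₁]
    [NormedAddCommGroup H₂] [InnerProductSpace ℂ H₂] (T : H₁ →ₗ.[ℂ] H₁) (S : H₂ →ₗ.[ℂ] H₂) : Prop :=
  ∃ U : H₁ ≃ₗᵢ[ℂ] H₂, ∀ f g : H₁, (f, g) ∈ T.graph ↔ (U f, U g) ∈ S.graph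

/-- `∂f/∂z`. -/
def dz (f : ℂ → ℂ) (z : ℂ) : ℂ := (fderiv ℝ f z 1 - Complex.I * fderiv ℝ f z Complex.I) / 2

/-- `∂f/∂z̄`. -/
def dbar (f : ℂ → ℂ) (z : ℂ) : ℂ := (fderiv ℝ f z 1 + Complex.I * fderiv ℝ f z Complex.I) / 2

/-- `∂F/∂z`, entry by entry. -/
def matDz (F : ℂ → Matrix (Fin 3) (Fin 3) ℂ) (z : ℂ) : Matrix (Fin 3) (Fin 3) ℂ :=
  Matrix.of fun i j => dz (fun u => F u i j) z

/-- `∂F/∂z̄`, entry by entry. -/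
def matDbar (F : ℂ → Matrix (Fin 3) (Fin 3) ℂ) (z : ℂ) : Matrix (Fin 3) (Fin 3) ℂ :=
  Matrix.of fun i j => dbar (fun u => F u i j) z

/-- `K(0,0)^{1/2}`; see `sqrtKer_posDef` and `sqrtKer_mul_self`. -/
def Params.sqrtKer (p : Params) : Matrix (Fin 3) (Fin 3) ℂ :=
  Matrix.diagonal fun l => (Real.sqrt (dVec 2 p.lam p.mu l) : ℂ)

lemma dVec_pos (p : Params) (l : Fin 3) : 0 < dVec 2 p.lam p.mu l := by
  have h := p.one_lt_lam
  have h1 : 0 < 2 * p.lam - 2 := by linarith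
  have h2 : 0 < 2 * p.lam - 1 := by linarith
  have h3 : 0 < p.lam := by linarith
  have h4 := p.mu₁_pos
  rw [dVec_two]
  fin_cases l
  · simp
  · simp; positivity
  · simp; positivity

lemma sqrtKer_posDef (p : Params) : p.sqrtKer.PosDef := by
  refine Matrix.posDef_diagonal_iff.mpr fun l => ?_
  exact_mod_cast Real.sqrt_pos.mpr (dVec_pos p l)

lemma sqrtKer_mul_self (p : Params) : p.sqrtKer * p.sqrtKer = p.ker 0 0 := by
  rw [Params.sqrtKer, Matrix.diagonal_mul_diagonal, Params.ker, kernel]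
  have h : matD 2 0 = 1 := by simp [matD]
  simp only [zero_mul, map_zero, zero_smul, NormedSpace.exp_zero, h, mul_one, one_mul, sub_zero,
    Complex.one_cpow, one_smul, matB]
  congr 1
  funext l
  rw [← Complex.ofReal_mul, Real.mul_self_sqrt (dVec_pos p l).le]

/-- The normalized kernel `K̃(z,w) = K(0,0)^{1/2} K(z,0)⁻¹ K(z,w) K(0,w)⁻¹ K(0,0)^{1/2}`. -/
def Params.normKer (p : Params) (z w : ℂ) : Matrix (Fin 3) (Fin 3) ℂ :=
  p.sqrtKer * (p.ker z 0)⁻¹ * p.ker z w * (p.ker 0 w)⁻¹ * p.sqrtKer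

/-- The Hermitian metric `h̃(z) = K̃(z,z)ᵗ`. -/
def Params.metric (p : Params) (z : ℂ) : Matrix (Fin 3) (Fin 3) ℂ := (p.normKer z z).transpose

/-- The curvature `𝒦_{λ,μ}(z) = ∂/∂z̄ (h̃⁻¹ ∂h̃/∂z)(z)`. -/
def Params.curvature (p : Params) (z : ℂ) : Matrix (Fin 3) (Fin 3) ℂ :=
  matDbar (fun u => (p.metric u)⁻¹ * matDz p.metric u) z

/-- The complex matrix `diag(x, y, t)`. -/
def diag3 (x y t : ℝ) : Matrix (Fin 3) (Fin 3) ℂ :=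
  Matrix.diagonal ![(x : ℂ), (y : ℂ), (t : ℂ)]

end KMKernel

end

/-!
The metric `h̃` is normalized at the origin: `h̃(0) = 1` and its first derivatives vanish there, so
the curvature at `0` is the mixed derivative `∂²h̃/∂z̄∂z (0)` (`HasMatJet.matDbar_inv_mul_matDz`).
Mixed derivatives are computed with jets, that is Taylor polynomials modulo `z²` and `z̄²`, which
multiply like polynomials (`HasJet.mul`, `HasMatJet.mul`). With `B = diag(d₀, d₁, d₂)` and
`N = diag(2, 1, 0)` the result (`hasMatJet_normKer`) is
`B^{1/2} (B⁻¹ (𝕊 B 𝕊* - N B - B N + (2λ + 2) B) B⁻¹ - 𝕊* B⁻¹ 𝕊) B^{1/2}`, a diagonal matrix with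
entries `δ₁ = 2λ - 2 - 1/d₁`, `δ₂ = 2λ + 1/d₁ - 4 d₁/d₂`, `δ₃ = 2λ + 2 + 4 d₁/d₂`
(`curvature_zero`).

Two consequences carry the theorem. First, `δ₁ + δ₂ + δ₃ = 6λ`, so that the curvature at `0`
determines `λ`, then `d₁` and `d₂`, then the parameters (`eq_of_curvature_zero_eq`). Secondly,
`δ₁ < 2λ - 2` and `2λ + 2 < δ₃`. If two curvatures at `0` have the same eigenvalues with
multiplicity, then they have the same `λ`, and so no first entry of one can be the third entry of
the other; if the parameters differ, only the two adjacent transpositions of the diagonal remain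
(`swap_of_trace_eq`). The inequalities on the `δᵢ` make the eigenvalues distinct, and exclude one of
the two transpositions because it violates `δ₁ < 2λ - 2` or `2λ + 2 < δ₃`. Operators that are not
unitarily equivalent have different parameters by reflexivity.
-/

namespace KMKernel

open scoped ComplexConjugate ComplexOrder Topology

/-! ### Wirtinger derivatives -/

lemma dz_add {f g : ℂ → ℂ} {z : ℂ} (hf : DifferentiableAt ℝ f z) (hg : DifferentiableAt ℝ g z) :
    dz (fun u => f u + g u) z = dz f z + dz g z := by
  simp only [dz, fderiv_fun_add hf hg, add_apply]
  ring

lemma dbar_add {f g : ℂ → ℂ} {z : ℂ} (hf : DifferentiableAt ℝ f z)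
    (hg : DifferentiableAt ℝ g z) :
    dbar (fun u => f u + g u) z = dbar f z + dbar g z := by
  simp only [dbar, fderiv_fun_add hf hg, add_apply]
  ring

lemma dz_mul {f g : ℂ → ℂ} {z : ℂ} (hf : DifferentiableAt ℝ f z) (hg : DifferentiableAt ℝ g z) :
    dz (fun u => f u * g u) z = f z * dz g z + dz f z * g z := by
  simp only [dz, fderiv_fun_mul hf hg, add_apply,
    smul_apply, smul_eq_mul]
  ring

lemma dbar_mul {f g : ℂ → ℂ} {z : ℂ} (hf : DifferentiableAt ℝ f z)
    (hg : DifferentiableAt ℝ g z) :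
    dbar (fun u => f u * g u) z = f z * dbar g z + dbar f z * g z := by
  simp only [dbar, fderiv_fun_mul hf hg, add_apply,
    smul_apply, smul_eq_mul]
  ring

lemma fderiv_comp_of_hasDerivAt {g f : ℂ → ℂ} {g' z : ℂ} (hg : HasDerivAt g g' (f z))
    (hf : DifferentiableAt ℝ f z) (v : ℂ) :
    fderiv ℝ (fun u => g (f u)) z v = g' * fderiv ℝ f z v := by
  have h := (hg.hasFDerivAt.restrictScalars ℝ).comp z hf.hasFDerivAt
  rw [show (fun u => g (f u)) = g ∘ f from rfl, h.fderiv]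
  simp [mul_comm]

lemma dz_comp {g f : ℂ → ℂ} {g' z : ℂ} (hg : HasDerivAt g g' (f z))
    (hf : DifferentiableAt ℝ f z) : dz (fun u => g (f u)) z = g' * dz f z := by
  simp only [dz, fderiv_comp_of_hasDerivAt hg hf]
  ring

lemma dbar_comp {g f : ℂ → ℂ} {g' z : ℂ} (hg : HasDerivAt g g' (f z))
    (hf : DifferentiableAt ℝ f z) : dbar (fun u => g (f u)) z = g' * dbar f z := by
  simp only [dbar, fderiv_comp_of_hasDerivAt hg hf]
  ring

lemma dbar_congr {f g : ℂ → ℂ} {z : ℂ} (h : f =ᶠ[𝓝 z] g) : dbar f z = dbar g z := by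
  simp only [dbar, h.fderiv_eq]

lemma differentiableAt_dz {f : ℂ → ℂ} {z : ℂ} (hf : ContDiffAt ℝ 2 f z) :
    DifferentiableAt ℝ (dz f) z := by
  have h : DifferentiableAt ℝ (fderiv ℝ f) z :=
    (hf.fderiv_right (m := 1) (by norm_num)).differentiableAt (by norm_num)
  unfold dz
  fun_prop

lemma eventually_differentiableAt {f : ℂ → ℂ} {z : ℂ} (hf : ContDiffAt ℝ 2 f z) :
    ∀ᶠ u in 𝓝 z, DifferentiableAt ℝ f u :=
  (hf.eventually (by norm_num)).mono fun _ h => h.differentiableAt (by norm_num)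

/-! ### Mixed jets at the origin -/

/-- `f` is twice real differentiable at `0`, and its value, `∂f/∂z`, `∂f/∂z̄` and `∂²f/∂z̄∂z` there
are `a`, `b`, `c`, `d`: that is, `a + b z + c z̄ + d z z̄` is the Taylor polynomial of `f` modulo
`z²` and `z̄²`. -/
structure HasJet (f : ℂ → ℂ) (a b c d : ℂ) : Prop where
  contDiffAt : ContDiffAt ℝ 2 f 0
  value : f 0 = a
  dz_eq : dz f 0 = b
  dbar_eq : dbar f 0 = c
  dbar_dz_eq : dbar (dz f) 0 = d

namespace HasJet

variable {f g : ℂ → ℂ} {a b c d a' b' c' d' : ℂ}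

lemma differentiableAt (h : HasJet f a b c d) : DifferentiableAt ℝ f 0 :=
  h.contDiffAt.differentiableAt (by norm_num)

protected lemma const (a : ℂ) : HasJet (fun _ => a) a 0 0 0 where
  contDiffAt := contDiffAt_const
  value := rfl
  dz_eq := by simp [dz]
  dbar_eq := by simp [dbar]
  dbar_dz_eq := by
    rw [show dz (fun _ => a) = fun _ => 0 from funext fun z => by simp [dz]]
    simp [dbar]

lemma of_linear (L : ℂ →L[ℝ] ℂ) :
    HasJet L 0 ((L 1 - Complex.I * L Complex.I) / 2) ((L 1 + Complex.I * L Complex.I) / 2) 0 where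
  contDiffAt := L.contDiff.contDiffAt
  value := map_zero L
  dz_eq := by simp [dz]
  dbar_eq := by simp [dbar]
  dbar_dz_eq := by
    rw [show dz L = fun _ => (L 1 - Complex.I * L Complex.I) / 2 from funext fun z => by simp [dz]]
    simp [dbar]

protected lemma id : HasJet (fun z => z) 0 1 0 0 := by
  simpa [Function.id_def] using of_linear (ContinuousLinearMap.id ℝ ℂ)

protected lemma star : HasJet (fun z => conj z) 0 0 1 0 := by
  have h : HasJet (fun z => conj z) 0 ((conj 1 - Complex.I * conj Complex.I) / 2)
      ((conj 1 + Complex.I * conj Complex.I) / 2) 0 :=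
    of_linear (Complex.conjCLE : ℂ →L[ℝ] ℂ)
  simpa using h

protected lemma add (hf : HasJet f a b c d) (hg : HasJet g a' b' c' d') :
    HasJet (fun z => f z + g z) (a + a') (b + b') (c + c') (d + d') where
  contDiffAt := hf.contDiffAt.add hg.contDiffAt
  value := by rw [hf.value, hg.value]
  dz_eq := by rw [dz_add hf.differentiableAt hg.differentiableAt, hf.dz_eq, hg.dz_eq]
  dbar_eq := by rw [dbar_add hf.differentiableAt hg.differentiableAt, hf.dbar_eq, hg.dbar_eq]
  dbar_dz_eq := by
    have h : dz (fun z => f z + g z) =ᶠ[𝓝 0] fun z => dz f z + dz g z := by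
      filter_upwards [eventually_differentiableAt hf.contDiffAt,
        eventually_differentiableAt hg.contDiffAt] with z h1 h2 using dz_add h1 h2
    rw [dbar_congr h, dbar_add (differentiableAt_dz hf.contDiffAt)
      (differentiableAt_dz hg.contDiffAt), hf.dbar_dz_eq, hg.dbar_dz_eq]

protected lemma mul (hf : HasJet f a b c d) (hg : HasJet g a' b' c' d') :
    HasJet (fun z => f z * g z) (a * a') (a * b' + b * a') (a * c' + c * a')
      (a * d' + b * c' + c * b' + d * a') where
  contDiffAt := hf.contDiffAt.mul hg.contDiffAt
  value := by rw [hf.value, hg.value]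
  dz_eq := by
    rw [dz_mul hf.differentiableAt hg.differentiableAt, hf.dz_eq, hg.dz_eq, hf.value, hg.value]
  dbar_eq := by
    rw [dbar_mul hf.differentiableAt hg.differentiableAt, hf.dbar_eq, hg.dbar_eq, hf.value,
      hg.value]
  dbar_dz_eq := by
    have h : dz (fun z => f z * g z) =ᶠ[𝓝 0] fun z => f z * dz g z + dz f z * g z := by
      filter_upwards [eventually_differentiableAt hf.contDiffAt,
        eventually_differentiableAt hg.contDiffAt] with z h1 h2 using dz_mul h1 h2
    have hf1 := hf.differentiableAt
    have hg1 := hg.differentiableAt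
    have hf2 := differentiableAt_dz hf.contDiffAt
    have hg2 := differentiableAt_dz hg.contDiffAt
    rw [dbar_congr h, dbar_add (hf1.fun_mul hg2) (hf2.fun_mul hg1), dbar_mul hf1 hg2, dbar_mul hf2 hg1,
      hf.value, hg.value, hf.dz_eq, hg.dz_eq, hf.dbar_eq, hg.dbar_eq, hf.dbar_dz_eq,
      hg.dbar_dz_eq]
    ring

/-- Chain rule for a holomorphic function applied to a function with a critical point. -/
lemma comp_analyticAt {φ : ℂ → ℂ} (hφ : AnalyticAt ℂ φ a) (hf : HasJet f a 0 0 d) :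
    HasJet (fun z => φ (f z)) (φ a) 0 0 (deriv φ a * d) := by
  have hφ0 : HasDerivAt φ (deriv φ a) (f 0) := by
    rw [hf.value]; exact hφ.differentiableAt.hasDerivAt
  have hφ1 : HasDerivAt (deriv φ) (deriv (deriv φ) a) (f 0) := by
    rw [hf.value]; exact hφ.deriv.differentiableAt.hasDerivAt
  have hf1 := hf.differentiableAt
  have hdd : DifferentiableAt ℝ (fun z => deriv φ (f z)) 0 :=
    (hφ1.differentiableAt.restrictScalars ℝ).comp (0 : ℂ) hf1
  refine ⟨?_, by rw [hf.value], ?_, ?_, ?_⟩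
  · have h : ContDiffAt ℝ 2 φ (f 0) := by
      rw [hf.value]; exact hφ.contDiffAt.restrict_scalars ℝ
    exact h.comp (0 : ℂ) hf.contDiffAt
  · rw [dz_comp hφ0 hf1, hf.dz_eq, mul_zero]
  · rw [dbar_comp hφ0 hf1, hf.dbar_eq, mul_zero]
  · have h : dz (fun z => φ (f z)) =ᶠ[𝓝 0] fun z => deriv φ (f z) * dz f z := by
      have hev : ∀ᶠ z in 𝓝 (0 : ℂ), AnalyticAt ℂ φ (f z) := by
        have := hφ.eventually_analyticAt
        rw [← hf.value] at this
        exact hf1.continuousAt.eventually this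
      filter_upwards [hev, eventually_differentiableAt hf.contDiffAt] with z h1 h2
      exact dz_comp h1.differentiableAt.hasDerivAt h2
    rw [dbar_congr h, dbar_mul hdd (differentiableAt_dz hf.contDiffAt), hf.dz_eq, hf.dbar_dz_eq,
      hf.value]
    ring

protected lemma sum {ι : Type*} (s : Finset ι) {f : ι → ℂ → ℂ} {a b c d : ι → ℂ}
    (h : ∀ i, HasJet (f i) (a i) (b i) (c i) (d i)) :
    HasJet (fun z => ∑ i ∈ s, f i z) (∑ i ∈ s, a i) (∑ i ∈ s, b i) (∑ i ∈ s, c i)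
      (∑ i ∈ s, d i) := by
  classical
  induction s using Finset.induction_on with
  | empty => simpa using HasJet.const 0
  | insert i s hi ih => simpa [Finset.sum_insert hi] using (h i).add ih

lemma one_sub_mul_conj : HasJet (fun z => 1 - z * conj z) 1 0 0 (-1) := by
  have h := (HasJet.const 1).add ((HasJet.const (-1)).mul (HasJet.id.mul HasJet.star))
  simpa [sub_eq_add_neg] using h

lemma one_sub_mul_conj_cpow (s : ℂ) : HasJet (fun z => (1 - z * conj z) ^ s) 1 0 0 (-s) := by
  have hφ : AnalyticAt ℂ (fun x : ℂ => x ^ s) 1 :=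
    analyticAt_id.cpow analyticAt_const (by simp)
  have hd : deriv (fun x : ℂ => x ^ s) 1 = s := by
    have := (hasDerivAt_id (1 : ℂ)).cpow_const (c := s) (by simp)
    simpa using this.deriv
  simpa [hd] using one_sub_mul_conj.comp_analyticAt hφ

end HasJet

/-- The entries of the matrix function `F` have jets given by the entries of `A`, `B`, `C`,
`D`. -/
def HasMatJet (F : ℂ → Matrix (Fin 3) (Fin 3) ℂ) (A B C D : Matrix (Fin 3) (Fin 3) ℂ) : Prop :=
  ∀ i j, HasJet (fun z => F z i j) (A i j) (B i j) (C i j) (D i j)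

namespace HasMatJet

variable {F G : ℂ → Matrix (Fin 3) (Fin 3) ℂ} {A B C D A' B' C' D' : Matrix (Fin 3) (Fin 3) ℂ}

protected lemma const (A : Matrix (Fin 3) (Fin 3) ℂ) : HasMatJet (fun _ => A) A 0 0 0 :=
  fun i j => HasJet.const (A i j)

protected lemma mul (hF : HasMatJet F A B C D) (hG : HasMatJet G A' B' C' D') :
    HasMatJet (fun z => F z * G z) (A * A') (A * B' + B * A') (A * C' + C * A')
      (A * D' + B * C' + C * B' + D * A') := by
  intro i j
  have h := HasJet.sum Finset.univ fun k => (hF i k).mul (hG k j)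
  simpa only [Matrix.mul_apply, Matrix.add_apply, Finset.sum_add_distrib] using h

protected lemma smul {f : ℂ → ℂ} {d : ℂ} (hf : HasJet f 1 0 0 d) (hF : HasMatJet F A B C D) :
    HasMatJet (fun z => f z • F z) A B C (D + d • A) := by
  intro i j
  simpa using hf.mul (hF i j)

protected lemma transpose (hF : HasMatJet F A B C D) :
    HasMatJet (fun z => (F z).transpose) A.transpose B.transpose C.transpose D.transpose :=
  fun i j => hF j i

lemma congr_coeffs (h : HasMatJet F A B C D) (hA : A = A') (hB : B = B') (hC : C = C')
    (hD : D = D') : HasMatJet F A' B' C' D' := by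
  subst hA hB hC hD
  exact h

/-- In a frame normalized at `0` the curvature of a Hermitian metric `h` is `∂²h/∂z̄∂z`: the
derivative of `h⁻¹` does not contribute, being multiplied by `∂h/∂z = 0`. -/
lemma matDbar_inv_mul_matDz (hF : HasMatJet F 1 0 C D) :
    matDbar (fun u => (F u)⁻¹ * matDz F u) 0 = D := by
  have hF0 : F 0 = 1 := Matrix.ext fun i j => (hF i j).value
  have hdiff : ∀ i j, DifferentiableAt ℝ (fun u => F u i j) 0 := fun i j =>
    (hF i j).differentiableAt
  have hinv : ∀ i j, DifferentiableAt ℝ (fun u => (F u)⁻¹ i j) 0 := by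
    intro i j
    have hdet : DifferentiableAt ℝ (fun u => ((F u).det)⁻¹) 0 := by
      refine DifferentiableAt.inv ?_ (by simp [hF0])
      simp only [Matrix.det_fin_three]
      fun_prop
    have hadj : DifferentiableAt ℝ (fun u => (F u).adjugate i j) 0 := by
      simp only [Matrix.adjugate_fin_three]
      fin_cases i <;> fin_cases j <;> simp <;> fun_prop
    simp only [Matrix.inv_def, Ring.inverse_eq_inv', Matrix.smul_apply, smul_eq_mul]
    exact hdet.mul hadj
  have hdz := fun i j => differentiableAt_dz (hF i j).contDiffAt
  ext i j
  simp only [matDbar, matDz, Matrix.of_apply, Matrix.mul_apply, Fin.sum_univ_three]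
  have hterm : ∀ k, DifferentiableAt ℝ
      (fun u => (F u)⁻¹ i k * dz (fun u => F u k j) u) 0 := fun k => (hinv i k).mul (hdz k j)
  rw [dbar_add ((hterm 0).fun_add (hterm 1)) (hterm 2), dbar_add (hterm 0) (hterm 1)]
  simp only [dbar_mul (hinv i _) (hdz _ j), (hF _ j).dz_eq, (hF _ j).dbar_dz_eq, hF0, inv_one,
    Matrix.zero_apply, mul_zero, add_zero]
  rw [← Fin.sum_univ_three (fun k => (1 : Matrix (Fin 3) (Fin 3) ℂ) i k * D k j),
    ← Matrix.mul_apply, one_mul]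

end HasMatJet

/-! ### The curvature at the origin -/

/-- For `w` with `∂w/∂z = 0` or `∂w/∂z̄ = 0` at `0` the square of `w • 𝕊` does not contribute, so
`exp (w • 𝕊)` has the jet of `1 + w • 𝕊`. -/
lemma hasMatJet_exp_shift {w : ℂ → ℂ} {b c : ℂ} (hw : HasJet w 0 b c 0) (hbc : b * c = 0) :
    HasMatJet (fun z => NormedSpace.exp (w z • shift 2)) 1 (b • shift 2) (c • shift 2) 0 := by
  have h2 : HasJet (fun z => w z ^ 2) 0 0 0 0 := by
    simpa [pow_two, mul_comm c, hbc] using hw.mul hw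
  have h3 : HasJet (fun z => 2 * w z) 0 (2 * b) (2 * c) 0 := by
    simpa using (HasJet.const 2).mul hw
  intro i j
  simp only [exp_shift]
  fin_cases i <;> fin_cases j <;>
    first
    | simpa [shift, mul_comm] using hw
    | simpa [shift, mul_comm] using h2
    | simpa [shift, mul_comm] using h3
    | simpa [shift] using HasJet.const 0
    | simpa [shift] using HasJet.const 1

lemma hasMatJet_exp_shift_adj {w : ℂ → ℂ} {b c : ℂ} (hw : HasJet w 0 b c 0) (hbc : b * c = 0) :
    HasMatJet (fun z => NormedSpace.exp (w z • (shift 2).conjTranspose)) 1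
      (b • (shift 2).transpose) (c • (shift 2).transpose) 0 := by
  have h := (hasMatJet_exp_shift hw hbc).transpose
  have hS : (shift 2).conjTranspose = (shift 2).transpose := by
    ext i j
    fin_cases i <;> fin_cases j <;> simp [shift]
  simpa [hS, ← Matrix.exp_transpose] using h

lemma hasMatJet_matD :
    HasMatJet (fun z => matD 2 (z * conj z)) 1 0 0 (-Matrix.diagonal ![2, 1, 0]) := by
  have h1 := HasJet.one_sub_mul_conj
  have h2 : HasJet (fun z => (1 - z * conj z) ^ 2) 1 0 0 (-2) := by
    simpa [pow_two, show (-1 + -1 : ℂ) = -2 by norm_num] using h1.mul h1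
  intro i j
  simp only [matD]
  fin_cases i <;> fin_cases j <;>
    first
    | simpa using h1
    | simpa using h2
    | simpa using HasJet.const 0
    | simpa using HasJet.const 1

lemma ker_zero_right (p : Params) (z : ℂ) :
    p.ker z 0 = matB 2 p.lam p.mu * NormedSpace.exp (z • (shift 2).conjTranspose) := by
  have h : matD 2 0 = 1 := by simp [matD]
  simp [Params.ker, kernel, h]

lemma ker_zero_left (p : Params) (w : ℂ) :
    p.ker 0 w = NormedSpace.exp (conj w • shift 2) * matB 2 p.lam p.mu := by
  have h : matD 2 0 = 1 := by simp [matD]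
  simp [Params.ker, kernel, h]

lemma hasMatJet_ker (p : Params) : HasMatJet (fun z => p.ker z z) (matB 2 p.lam p.mu)
    (matB 2 p.lam p.mu * (shift 2).transpose) (shift 2 * matB 2 p.lam p.mu)
    (shift 2 * matB 2 p.lam p.mu * (shift 2).transpose
      - Matrix.diagonal ![2, 1, 0] * matB 2 p.lam p.mu
      - matB 2 p.lam p.mu * Matrix.diagonal ![2, 1, 0]
      + (2 * (p.lam : ℂ) + 2) • matB 2 p.lam p.mu) := by
  have h := HasMatJet.smul (HasJet.one_sub_mul_conj_cpow (-(2 * (p.lam : ℂ)) - (2 : ℕ)))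
    ((((hasMatJet_matD.mul (hasMatJet_exp_shift HasJet.star (by simp))).mul
      (HasMatJet.const (matB 2 p.lam p.mu))).mul
      (hasMatJet_exp_shift_adj HasJet.id (by simp))).mul hasMatJet_matD)
  refine HasMatJet.congr_coeffs h ?_ ?_ ?_ ?_
  · simp only [one_mul, mul_one]
  · simp only [one_mul, mul_one, one_smul, zero_smul, mul_zero, zero_mul, add_zero, zero_add]
  · simp only [one_mul, mul_one, one_smul, zero_smul, mul_zero, add_zero, zero_add]
  · simp only [one_mul, mul_one, one_smul, zero_smul, mul_zero, zero_mul, add_zero, zero_add,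
      mul_neg, neg_mul]
    rw [show -(-(2 * (p.lam : ℂ)) - (2 : ℕ)) = 2 * (p.lam : ℂ) + 2 by push_cast; ring]
    abel

lemma hasMatJet_ker_zero_right_inv (p : Params) : HasMatJet (fun z => (p.ker z 0)⁻¹)
    (matB 2 p.lam p.mu)⁻¹ (-((shift 2).transpose * (matB 2 p.lam p.mu)⁻¹)) 0 0 := by
  have hz : HasJet (fun z => -z) 0 (-1) 0 0 := by
    simpa using (HasJet.const (-1)).mul HasJet.id
  simpa [ker_zero_right, Matrix.mul_inv_rev, ← Matrix.exp_neg] using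
    (hasMatJet_exp_shift_adj hz (by simp)).mul (HasMatJet.const (matB 2 p.lam p.mu)⁻¹)

lemma hasMatJet_ker_zero_left_inv (p : Params) : HasMatJet (fun z => (p.ker 0 z)⁻¹)
    (matB 2 p.lam p.mu)⁻¹ 0 (-((matB 2 p.lam p.mu)⁻¹ * shift 2)) 0 := by
  have hz : HasJet (fun z => -conj z) 0 0 (-1) 0 := by
    simpa using (HasJet.const (-1)).mul HasJet.star
  simpa [ker_zero_left, Matrix.mul_inv_rev, ← Matrix.exp_neg] using
    (HasMatJet.const (matB 2 p.lam p.mu)⁻¹).mul (hasMatJet_exp_shift hz (by simp))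

lemma sqrtKer_mul_self_eq_matB (p : Params) : p.sqrtKer * p.sqrtKer = matB 2 p.lam p.mu := by
  rw [sqrtKer_mul_self, ker_zero_right, zero_smul, NormedSpace.exp_zero, mul_one]

lemma isUnit_det_sqrtKer (p : Params) : IsUnit p.sqrtKer.det :=
  (Matrix.isUnit_iff_isUnit_det _).mp (sqrtKer_posDef p).isUnit

lemma isUnit_det_matB (p : Params) : IsUnit (matB 2 p.lam p.mu).det := by
  rw [← sqrtKer_mul_self_eq_matB, Matrix.det_mul]
  exact (isUnit_det_sqrtKer p).mul (isUnit_det_sqrtKer p)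

lemma sqrtKer_mul_inv_mul_sqrtKer (p : Params) :
    p.sqrtKer * (matB 2 p.lam p.mu)⁻¹ * p.sqrtKer = 1 := by
  rw [← sqrtKer_mul_self_eq_matB, Matrix.mul_inv_rev, ← mul_assoc,
    Matrix.mul_nonsing_inv _ (isUnit_det_sqrtKer p), one_mul,
    Matrix.nonsing_inv_mul _ (isUnit_det_sqrtKer p)]

/-- Multiplying by `K(z,0)⁻¹` and `K(0,w)⁻¹` removes the pure derivatives of the kernel, which is
what makes the frame normalized; the mixed derivative loses the term `𝕊* B⁻¹ 𝕊`. -/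
lemma hasMatJet_normKer (p : Params) :
    HasMatJet (fun z => p.normKer z z) 1 0 0
      (p.sqrtKer * ((matB 2 p.lam p.mu)⁻¹ *
        (shift 2 * matB 2 p.lam p.mu * (shift 2).transpose
          - Matrix.diagonal ![2, 1, 0] * matB 2 p.lam p.mu
          - matB 2 p.lam p.mu * Matrix.diagonal ![2, 1, 0]
          + (2 * (p.lam : ℂ) + 2) • matB 2 p.lam p.mu) * (matB 2 p.lam p.mu)⁻¹
        - (shift 2).transpose * (matB 2 p.lam p.mu)⁻¹ * shift 2) * p.sqrtKer) := by
  have h := ((((HasMatJet.const p.sqrtKer).mul (hasMatJet_ker_zero_right_inv p)).mul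
    (hasMatJet_ker p)).mul (hasMatJet_ker_zero_left_inv p)).mul (HasMatJet.const p.sqrtKer)
  have h₃ := sqrtKer_mul_inv_mul_sqrtKer p
  have e₁ : ∀ X, X * matB 2 p.lam p.mu * (matB 2 p.lam p.mu)⁻¹ = X := fun X =>
    Matrix.mul_nonsing_inv_cancel_right _ X (isUnit_det_matB p)
  have e₂ : ∀ X, X * (matB 2 p.lam p.mu)⁻¹ * matB 2 p.lam p.mu = X := fun X =>
    Matrix.nonsing_inv_mul_cancel_right _ X (isUnit_det_matB p)
  refine HasMatJet.congr_coeffs h ?_ ?_ ?_ ?_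
  · rw [e₂, h₃]
  · simp only [mul_zero, zero_mul, add_zero, mul_neg, neg_mul, ← mul_assoc, e₂, add_neg_cancel]
  · simp only [mul_zero, zero_mul, add_zero, mul_neg, ← mul_assoc, e₁, e₂, neg_add_cancel]
  · generalize shift 2 * matB 2 p.lam p.mu * (shift 2).transpose
        - Matrix.diagonal ![2, 1, 0] * matB 2 p.lam p.mu
        - matB 2 p.lam p.mu * Matrix.diagonal ![2, 1, 0]
        + (2 * (p.lam : ℂ) + 2) • matB 2 p.lam p.mu = X
    simp only [mul_zero, zero_mul, add_zero, zero_add, mul_neg, neg_mul, ← mul_assoc, e₁, e₂,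
      mul_sub, sub_mul, add_mul]
    abel

lemma shift_mul_diagonal_mul_transpose (d : Fin 3 → ℂ) :
    shift 2 * Matrix.diagonal d * (shift 2).transpose
      = Matrix.diagonal ![0, d 0, 4 * d 1] := by
  ext i j
  rw [Matrix.mul_apply, Fin.sum_univ_three]
  fin_cases i <;> fin_cases j <;> simp [Matrix.mul_diagonal, shift]; ring

lemma shift_transpose_mul_diagonal_mul (d : Fin 3 → ℂ) :
    (shift 2).transpose * Matrix.diagonal d * shift 2
      = Matrix.diagonal ![d 1, 4 * d 2, 0] := by
  ext i j
  rw [Matrix.mul_apply, Fin.sum_univ_three]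
  fin_cases i <;> fin_cases j <;> simp [Matrix.mul_diagonal, shift]; ring

/-- Every matrix in the mixed derivative of the normalized kernel becomes diagonal, and the
curvature at `0` is `diag(2λ - 2 - x, 2λ + x - y, 2λ + 2 + y)` with `x = 1 / d₁`,
`y = 4 d₁ / d₂`. -/
lemma curvature_zero (p : Params) : p.curvature 0 =
    diag3 (2 * p.lam - 2 - 1 / dVec 2 p.lam p.mu 1)
      (2 * p.lam + 1 / dVec 2 p.lam p.mu 1 - 4 * (dVec 2 p.lam p.mu 1 / dVec 2 p.lam p.mu 2))
      (2 * p.lam + 2 + 4 * (dVec 2 p.lam p.mu 1 / dVec 2 p.lam p.mu 2)) := by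
  set s₁ : ℂ := (Real.sqrt (dVec 2 p.lam p.mu 1) : ℂ) with hs₁
  set s₂ : ℂ := (Real.sqrt (dVec 2 p.lam p.mu 2) : ℂ) with hs₂
  have hd₁ : ((dVec 2 p.lam p.mu 1 : ℝ) : ℂ) = s₁ ^ 2 := by
    rw [hs₁, ← Complex.ofReal_pow, Real.sq_sqrt (dVec_pos p 1).le]
  have hd₂ : ((dVec 2 p.lam p.mu 2 : ℝ) : ℂ) = s₂ ^ 2 := by
    rw [hs₂, ← Complex.ofReal_pow, Real.sq_sqrt (dVec_pos p 2).le]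
  have hn₁ : s₁ ≠ 0 := by
    rw [hs₁, Complex.ofReal_ne_zero]; exact (Real.sqrt_pos.mpr (dVec_pos p 1)).ne'
  have hn₂ : s₂ ≠ 0 := by
    rw [hs₂, Complex.ofReal_ne_zero]; exact (Real.sqrt_pos.mpr (dVec_pos p 2)).ne'
  have hd₀ : dVec 2 p.lam p.mu 0 = 1 := by rw [dVec_two]; rfl
  have hR : p.sqrtKer = Matrix.diagonal ![1, s₁, s₂] := by
    rw [Params.sqrtKer]
    congr 1
    ext l
    fin_cases l <;> simp [hd₀, hs₁, hs₂]
  have hB : matB 2 p.lam p.mu = Matrix.diagonal ![1, s₁ ^ 2, s₂ ^ 2] := by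
    rw [matB]
    congr 1
    ext l
    fin_cases l <;> simp [hd₀, hd₁, hd₂]
  have hBi : (matB 2 p.lam p.mu)⁻¹ = Matrix.diagonal ![1, (s₁ ^ 2)⁻¹, (s₂ ^ 2)⁻¹] := by
    rw [hB]
    refine Matrix.inv_eq_right_inv ?_
    ext i j
    fin_cases i <;> fin_cases j <;> simp [hn₁, hn₂]
  have hjet := (hasMatJet_normKer p).transpose
  rw [Matrix.transpose_one, Matrix.transpose_zero] at hjet
  have key := hjet.matDbar_inv_mul_matDz
  rw [hBi, hB, hR] at key
  refine key.trans ?_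
  rw [shift_mul_diagonal_mul_transpose, shift_transpose_mul_diagonal_mul]
  simp only [Matrix.diagonal_mul_diagonal, Matrix.diagonal_sub, Matrix.diagonal_add,
    ← Matrix.diagonal_smul, Matrix.diagonal_transpose, diag3]
  congr 1
  ext l
  fin_cases l
  · simp [hd₁, hd₂]
    ring
  · simp [hd₁, hd₂]
    field_simp
    ring
  · simp [hd₁, hd₂]
    field_simp
    ring

/-! ### The parameters from the curvature -/

lemma diag_entries_of_curvature_zero_eq {p : Params} {a b c : ℝ} (h : p.curvature 0 = diag3 a b c) :
    a = 2 * p.lam - 2 - 1 / dVec 2 p.lam p.mu 1 ∧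
    b = 2 * p.lam + 1 / dVec 2 p.lam p.mu 1 - 4 * (dVec 2 p.lam p.mu 1 / dVec 2 p.lam p.mu 2) ∧
    c = 2 * p.lam + 2 + 4 * (dVec 2 p.lam p.mu 1 / dVec 2 p.lam p.mu 2) := by
  rw [curvature_zero, diag3, diag3, Matrix.diagonal_eq_diagonal_iff] at h
  have h0 := h 0
  have h1 := h 1
  have h2 := h 2
  simp only [Matrix.cons_val] at h0 h1 h2
  exact ⟨by exact_mod_cast h0.symm, by exact_mod_cast h1.symm, by exact_mod_cast h2.symm⟩

lemma exists_curvature_zero_eq (p : Params) : ∃ a b c : ℝ, p.curvature 0 = diag3 a b c :=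
  ⟨_, _, _, curvature_zero p⟩

lemma six_mul_lam_eq {p : Params} {a b c : ℝ} (h : p.curvature 0 = diag3 a b c) :
    6 * p.lam = a + b + c := by
  obtain ⟨ha, hb, hc⟩ := diag_entries_of_curvature_zero_eq h
  linarith

lemma first_lt_of_curvature_zero_eq {p : Params} {a b c : ℝ} (h : p.curvature 0 = diag3 a b c) :
    a < 2 * p.lam - 2 := by
  obtain ⟨ha, -, -⟩ := diag_entries_of_curvature_zero_eq h
  have := one_div_pos.mpr (dVec_pos p 1)
  linarith

lemma lt_third_of_curvature_zero_eq {p : Params} {a b c : ℝ} (h : p.curvature 0 = diag3 a b c) :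
    2 * p.lam + 2 < c := by
  obtain ⟨-, -, hc⟩ := diag_entries_of_curvature_zero_eq h
  have := div_pos (dVec_pos p 1) (dVec_pos p 2)
  linarith

/-- The trace gives `λ`, the outer diagonal entries then give `d₁` and `d₂`, and the triangular
system `d = L(λ) μ²` gives `μ₁²` and `μ₂²`. -/
lemma eq_of_curvature_zero_eq {p q : Params} (h : p.curvature 0 = q.curvature 0) : p = q := by
  obtain ⟨a, b, c, hp⟩ := exists_curvature_zero_eq p
  have hq := h.symm.trans hp
  have hl : p.lam = q.lam := by linarith [six_mul_lam_eq hp, six_mul_lam_eq hq]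
  obtain ⟨ha, -, hc⟩ := diag_entries_of_curvature_zero_eq hp
  obtain ⟨ha', -, hc'⟩ := diag_entries_of_curvature_zero_eq hq
  rw [hl] at ha hc
  have h1 : dVec 2 p.lam p.mu 1 = dVec 2 q.lam q.mu 1 := by
    rw [hl]
    refine inv_injective ?_
    rw [← one_div, ← one_div]
    linarith
  have h2 : dVec 2 p.lam p.mu 2 = dVec 2 q.lam q.mu 2 := by
    have hd : dVec 2 p.lam p.mu 1 / dVec 2 p.lam p.mu 2
        = dVec 2 q.lam q.mu 1 / dVec 2 q.lam q.mu 2 := by rw [hl]; linarith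
    rw [h1] at hd
    rwa [div_eq_div_iff (dVec_pos p 2).ne' (dVec_pos q 2).ne',
      mul_right_inj' (dVec_pos q 1).ne', eq_comm] at hd
  rw [dVec_two, dVec_two, hl] at h1 h2
  simp only [Matrix.cons_val] at h1 h2
  have hm₁ : p.mu₁ ^ 2 = q.mu₁ ^ 2 := by linarith
  rw [hm₁] at h2
  have hm₂ : p.mu₂ ^ 2 = q.mu₂ ^ 2 := by linarith
  exact Params.ext hl ((pow_left_inj₀ p.mu₁_pos.le q.mu₁_pos.le two_ne_zero).mp hm₁)
    ((pow_left_inj₀ p.mu₂_pos.le q.mu₂_pos.le two_ne_zero).mp hm₂)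

/-! ### Rearrangements of the eigenvalues -/

lemma unitarilyEquivalent_refl {H : Type*} [NormedAddCommGroup H] [InnerProductSpace ℂ H]
    (T : H →ₗ.[ℂ] H) : UnitarilyEquivalent T T :=
  ⟨LinearIsometryEquiv.refl ℂ H, fun _ _ => Iff.rfl⟩

lemma spectrum_diag3 (a b c : ℝ) : spectrum ℂ (diag3 a b c) = {(a : ℂ), (b : ℂ), (c : ℂ)} := by
  rw [diag3, spectrum_diagonal]
  ext x
  simp only [Matrix.range_cons, Matrix.range_empty, Set.union_empty, Set.mem_union,
    Set.mem_singleton_iff, Set.mem_insert_iff]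

lemma roots_charpoly_diag3 (a b c : ℝ) :
    (diag3 a b c).charpoly.roots = {(a : ℂ), (b : ℂ), (c : ℂ)} := by
  rw [diag3, Matrix.charpoly_diagonal, Fin.prod_univ_three,
    ← Polynomial.roots_multiset_prod_X_sub_C {(a : ℂ), (b : ℂ), (c : ℂ)}]
  simp [mul_assoc]

/-- The inequalities `δ₁ < 2λ - 2` and `2λ + 2 < δ₃` rule out every rearrangement of the diagonal
of the curvature except the two adjacent transpositions. Since `λ` is the trace over `6`, they are
the same inequalities for both operators. -/
lemma swap_of_trace_eq {p q : Params} {a b c a' b' c' : ℝ}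
    (hp : p.curvature 0 = diag3 a b c) (hq : q.curvature 0 = diag3 a' b' c')
    (hsum : a' + b' + c' = a + b + c) (ha : a' = a ∨ a' = b ∨ a' = c)
    (hc : c' = a ∨ c' = b ∨ c' = c) (hpq : q ≠ p) :
    (a' = b ∧ b' = a ∧ c' = c) ∨ (a' = a ∧ b' = c ∧ c' = b) := by
  have l₁ := six_mul_lam_eq hp
  have l₂ := six_mul_lam_eq hq
  have f₁ := first_lt_of_curvature_zero_eq hp
  have f₂ := first_lt_of_curvature_zero_eq hq
  have t₁ := lt_third_of_curvature_zero_eq hp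
  have t₂ := lt_third_of_curvature_zero_eq hq
  rcases ha with rfl | rfl | rfl
  · rcases hc with rfl | rfl | rfl
    · linarith
    · exact Or.inr ⟨rfl, by linarith, rfl⟩
    · obtain rfl : b' = b := by linarith
      exact absurd (eq_of_curvature_zero_eq (hq.trans hp.symm)) hpq
  · rcases hc with rfl | rfl | rfl
    · linarith
    · linarith
    · exact Or.inl ⟨rfl, by linarith, rfl⟩
  · linarith

/-- Three distinct eigenvalues leave no room for different multiplicities. -/
lemma swap_of_spectrum_eq {p q : Params} {a b c a' b' c' : ℝ}
    (hp : p.curvature 0 = diag3 a b c) (hq : q.curvature 0 = diag3 a' b' c')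
    (h : spectrum ℂ (q.curvature 0) = spectrum ℂ (p.curvature 0))
    (hab : a ≠ b) (hac : a ≠ c) (hbc : b ≠ c) (hpq : q ≠ p) :
    (a' = b ∧ b' = a ∧ c' = c) ∨ (a' = a ∧ b' = c ∧ c' = b) := by
  rw [hp, hq, spectrum_diag3, spectrum_diag3, Set.ext_iff] at h
  have key : ∀ x : ℝ, x = a' ∨ x = b' ∨ x = c' ↔ x = a ∨ x = b ∨ x = c := by
    intro x
    simpa using h x
  refine swap_of_trace_eq hp hq ?_ ((key a').mp (by simp)) ((key c').mp (by simp)) hpq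
  have := key a
  have := key b
  have := key c
  have := key a'
  have := key b'
  have := key c'
  grind

lemma swap_of_roots_charpoly_eq {p q : Params} {a b c a' b' c' : ℝ}
    (hp : p.curvature 0 = diag3 a b c) (hq : q.curvature 0 = diag3 a' b' c')
    (h : (q.curvature 0).charpoly.roots = (p.curvature 0).charpoly.roots) (hpq : q ≠ p) :
    (a' = b ∧ b' = a ∧ c' = c) ∨ (a' = a ∧ b' = c ∧ c' = b) := by
  rw [hp, hq, roots_charpoly_diag3, roots_charpoly_diag3] at h
  have key : ∀ x : ℝ, x = a' ∨ x = b' ∨ x = c' ↔ x = a ∨ x = b ∨ x = c := by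
    intro x
    simpa using iff_of_eq (congrArg (fun s => (x : ℂ) ∈ s) h)
  have hsum : (a' + b' + c' : ℂ) = a + b + c := by
    simpa [add_assoc] using congrArg Multiset.sum h
  exact swap_of_trace_eq hp hq (by exact_mod_cast hsum) ((key a').mp (by simp))
    ((key c').mp (by simp)) hpq

end KMKernel

theorem mainTheorem9 :
    (∀ δ₁ δ₂ δ₃ : ℝ, 0 < δ₁ → 0 < δ₂ → 0 < δ₃ → δ₁ ≠ δ₂ →
      max (2 * δ₁ - δ₂) (2 * δ₂ - δ₁) < δ₃ - 6 → δ₃ - 6 < 2 * (δ₁ + δ₂) →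
      ∀ p pTilde : KMKernel.Params,
        p.curvature 0 = KMKernel.diag3 δ₁ δ₂ δ₃ →
        pTilde.curvature 0 = KMKernel.diag3 δ₂ δ₁ δ₃ →
        ∀ q : KMKernel.Params,
          ¬ KMKernel.UnitarilyEquivalent q.mulOp p.mulOp →
          spectrum ℂ (q.curvature 0) = spectrum ℂ (p.curvature 0) →
          q = pTilde) ∧
    (∀ δ₁ δ₂ δ₃ : ℝ, 0 < δ₁ → 0 < δ₂ → 0 < δ₃ → δ₂ < δ₃ → 3 + δ₃ / 2 < δ₂ →
      δ₁ < min (2 * δ₃ - δ₂) (2 * δ₂ - δ₃) - 6 →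
      ∀ p pHat : KMKernel.Params,
        p.curvature 0 = KMKernel.diag3 δ₁ δ₂ δ₃ →
        pHat.curvature 0 = KMKernel.diag3 δ₁ δ₃ δ₂ →
        ∀ q : KMKernel.Params,
          ¬ KMKernel.UnitarilyEquivalent q.mulOp p.mulOp →
          spectrum ℂ (q.curvature 0) = spectrum ℂ (p.curvature 0) →
          q = pHat) ∧
    (∀ (δ₁ δ₂ δ₃ : ℝ) (p q : KMKernel.Params),
      p.curvature 0 = KMKernel.diag3 δ₁ δ₂ δ₃ →
      ¬ KMKernel.UnitarilyEquivalent q.mulOp p.mulOp →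
      (q.curvature 0).charpoly.roots = (p.curvature 0).charpoly.roots →
      q.curvature 0 = KMKernel.diag3 δ₂ δ₁ δ₃ ∨ q.curvature 0 = KMKernel.diag3 δ₁ δ₃ δ₂) := by
  have hne : ∀ {p q : KMKernel.Params}, ¬ KMKernel.UnitarilyEquivalent q.mulOp p.mulOp → q ≠ p := by
    rintro p _ h rfl
    exact h (KMKernel.unitarilyEquivalent_refl _)
  refine ⟨?_, ?_, ?_⟩
  · intro δ₁ δ₂ δ₃ _ _ _ h₁₂ hmax _ p pTilde hp hpt q hu hs
    obtain ⟨hm₁, hm₂⟩ := max_lt_iff.mp hmax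
    have h₁₃ : δ₁ < δ₃ := by
      linarith [KMKernel.first_lt_of_curvature_zero_eq hp,
        KMKernel.lt_third_of_curvature_zero_eq hp]
    have h₂₃ : δ₂ < δ₃ := by linarith
    obtain ⟨a, b, c, hq⟩ := KMKernel.exists_curvature_zero_eq q
    rcases KMKernel.swap_of_spectrum_eq hp hq hs h₁₂ h₁₃.ne h₂₃.ne (hne hu) with
      ⟨rfl, rfl, rfl⟩ | ⟨rfl, rfl, rfl⟩
    · exact KMKernel.eq_of_curvature_zero_eq (hq.trans hpt.symm)
    -- the other transposition would need `2λ + 2 < δ₂`, that is `δ₃ + 6 < 2 * δ₂ - δ₁`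
    · linarith [KMKernel.six_mul_lam_eq hq, KMKernel.lt_third_of_curvature_zero_eq hq]
  · intro δ₁ δ₂ δ₃ _ _ _ h₂₃ _ hmin p pHat hp hph q hu hs
    have hm₁ := min_le_left (2 * δ₃ - δ₂) (2 * δ₂ - δ₃)
    have hm₂ := min_le_right (2 * δ₃ - δ₂) (2 * δ₂ - δ₃)
    have h₁₂ : δ₁ < δ₂ := by linarith
    obtain ⟨a, b, c, hq⟩ := KMKernel.exists_curvature_zero_eq q
    rcases KMKernel.swap_of_spectrum_eq hp hq hs h₁₂.ne (h₁₂.trans h₂₃).ne h₂₃.ne (hne hu) with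
      ⟨rfl, rfl, rfl⟩ | ⟨rfl, rfl, rfl⟩
    -- the other transposition would need `δ₂ < 2λ - 2`, that is `2 * δ₂ - δ₃ + 6 < δ₁`
    · linarith [KMKernel.six_mul_lam_eq hq, KMKernel.first_lt_of_curvature_zero_eq hq]
    · exact KMKernel.eq_of_curvature_zero_eq (hq.trans hph.symm)
  · intro δ₁ δ₂ δ₃ p q hp hu hr
    obtain ⟨a, b, c, hq⟩ := KMKernel.exists_curvature_zero_eq q
    rcases KMKernel.swap_of_roots_charpoly_eq hp hq hr (hne hu) with
      ⟨rfl, rfl, rfl⟩ | ⟨rfl, rfl, rfl⟩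
    · exact Or.inl hq
    · exact Or.inr hq
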